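/- Let $(X,\Sigma,\mu)$ be a Lebesgue space (standard probability space), and let $G$ be a countable group acting on $X$ by measurable, measure-preserving transformations, ergodically. Let $\mathcal R=\{(x,y)\in X\times X : x\in Gy\}$ be the orbit equivalence relation, equipped with the measure $\nu(A)=\int_X |\{z : (z,x)\in A\}|\,d\mu(x)$. On the complex Hilbert space $L^2(\mathcal R,\nu)$ put $$(\pi(g)f)(x,y)=f(g^{-1}x,y),\qquad (\tilde\pi(g)f)(x,y)=f(x,g^{-1}y),\qquad \rho(g_1,g_2)=\pi(g_1)\tilde\pi(g_2)\quad(g,g_1,g_2\in G),$$ and let $\mathcal M_\rho$ be the von Neumann algebra generated by the operators $\rho(g_1,g_2)$, $g_1,g_2\in G$. Let $\xi\in L^2(\mathcal R,\nu)$ be given by $\xi(x,y)=\delta_{x,y}$, and let $P_\xi$ be the orthogonal projection of $L^2(\mathcal R,\nu)$ onto $\mathbb C\xi$. For a subgroup $H\leqslant G$ let $\mathrm{comm}_G(H)$ be the subgroup of all $g\in G$ such that $H\cap gHg^{-1}$ has finite index in both $H$ and $gHg^{-1}$, and let $\mathrm{St}_G(x)=\{g\in G: gx=x\}$. Suppose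 that $\mathrm{comm}_G(\mathrm{St}_G(x))=\mathrm{St}_G(x)$ for $\mu$-almost every $x\in X$. Then $\xi$ is a unit vector and, up to scalar multiplication, the unique vector fixed by $\rho(g,g)$ for all $g\in G$; that is, the vectors $\eta\in L^2(\mathcal R,\nu)$ with $\rho(g,g)\eta=\eta$ for all $g\in G$ are exactly the vectors $c\,\xi$, $c\in\mathbb C$. Consequently $P_\xi\in\mathcal M_\rho$. -/

import Mathlib

open MeasureTheory
open scoped ENNReal

noncomputable section

/-- A Lebesgue (standard probability) space: a probability space whose `σ`-algebra contains a
standard Borel `σ`-algebra and exceeds it only by `μ`-null modifications of its members. Both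
extreme cases are included: standard Borel probability spaces, and their completions (the
Lebesgue spaces in Rokhlin's sense, up to a null set: an interval with the Lebesgue measurable
sets, countably many atoms, or a disjoint union of both). -/
class IsLebesgueSpace {X : Type*} [m : MeasurableSpace X] (μ : Measure X) : Prop
    extends IsProbabilityMeasure μ where
  exists_standardBorel : ∃ m₀ : MeasurableSpace X, m₀ ≤ m ∧ @StandardBorelSpace X m₀ ∧
    ∀ s : Set X, MeasurableSet[m] s → ∃ t : Set X, MeasurableSet[m₀] t ∧ s =ᵐ[μ] t

theorem measurableEq_of_standardBorel (X : Type*) [MeasurableSpace X] [StandardBorelSpace X] :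
    MeasurableEq X := inferInstance

theorem IsLebesgueSpace.measurableEq {X : Type*} [m : MeasurableSpace X] (μ : Measure X)
    [h : IsLebesgueSpace μ] : MeasurableEq X := by
  obtain ⟨m₀, hle, hs, -⟩ := h.exists_standardBorel
  have h0 : @MeasurableEq X m₀ := @measurableEq_of_standardBorel X m₀ hs
  exact @MeasurableEq.mk X m
    ((sup_le_sup (MeasurableSpace.comap_mono hle) (MeasurableSpace.comap_mono hle)) _
      (@measurableSet_diagonal X m₀ h0))

/-- The von Neumann algebra generated by a set `S` of bounded operators: the double commutant of
`S ∪ S*`. -/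
def generatedVonNeumannAlgebra {H : Type*} [NormedAddCommGroup H] [InnerProductSpace ℂ H]
    [CompleteSpace H] (S : Set (H →L[ℂ] H)) : VonNeumannAlgebra H where
  toStarSubalgebra :=
    StarSubalgebra.centralizer ℂ (StarSubalgebra.centralizer ℂ S : Set (H →L[ℂ] H))
  centralizer_centralizer' := by
    change Set.centralizer (Set.centralizer
      (StarSubalgebra.centralizer ℂ (StarSubalgebra.centralizer ℂ S : Set (H →L[ℂ] H)) :
        Set (H →L[ℂ] H))) =
      (StarSubalgebra.centralizer ℂ (StarSubalgebra.centralizer ℂ S : Set (H →L[ℂ] H)) :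
        Set (H →L[ℂ] H))
    rw [StarSubalgebra.coe_centralizer_centralizer]
    simp

/-- It is the smallest von Neumann algebra containing `S`. -/
theorem isLeast_generatedVonNeumannAlgebra {H : Type*} [NormedAddCommGroup H]
    [InnerProductSpace ℂ H] [CompleteSpace H] (S : Set (H →L[ℂ] H)) :
    IsLeast {M : VonNeumannAlgebra H | S ⊆ (M : Set (H →L[ℂ] H))}
      (generatedVonNeumannAlgebra S) := by
  have hc : (generatedVonNeumannAlgebra S : Set (H →L[ℂ] H)) =
      (S ∪ star S).centralizer.centralizer :=
    StarSubalgebra.coe_centralizer_centralizer ℂ S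
  refine ⟨?_, ?_⟩
  · change S ⊆ (generatedVonNeumannAlgebra S : Set (H →L[ℂ] H))
    rw [hc]
    exact Set.subset_union_left.trans Set.subset_centralizer_centralizer
  · intro M hM
    change (generatedVonNeumannAlgebra S : Set (H →L[ℂ] H)) ⊆ (M : Set (H →L[ℂ] H))
    rw [hc, ← M.centralizer_centralizer]
    refine Set.centralizer_subset (Set.centralizer_subset (Set.union_subset hM ?_))
    intro a ha
    have : star a ∈ M := hM ha
    simpa using star_mem this

namespace OrbitGroupoid

section Defs

variable (G : Type*) {X : Type*} [Group G] [MulAction G X]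

/-- The orbit equivalence relation `ℛ = {(x, y) : x ∈ G y} ⊆ X × X`; it carries the `σ`-algebra
induced from the product `σ`-algebra. -/
abbrev Rel (G X : Type*) [Group G] [MulAction G X] : Type _ :=
  {p : X × X // p.1 ∈ MulAction.orbit G p.2}

/-- The fiber `{z : (z, x) ∈ A}` of `A ⊆ ℛ` over `x`, that is, `A_x = A ∩ (X × {x})`. -/
def fiber (A : Set (Rel G X)) (x : X) : Set X :=
  {z | ∃ h : z ∈ MulAction.orbit G x, (⟨(z, x), h⟩ : Rel G X) ∈ A}

variable [MeasurableSpace X]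

theorem measurable_encard_fiber [Countable G] [MeasurableEq X] [MeasurableConstSMul G X]
    {A : Set (Rel G X)} (hA : MeasurableSet A) :
    Measurable fun x => ((fiber G A x).encard : ℝ≥0∞) := by
  obtain ⟨B, hB, rfl⟩ := hA
  obtain ⟨f, hf⟩ := exists_surjective_nat G
  let N : X → Set ℕ := fun x => {n | (f n • x, x) ∈ B ∧ ∀ k < n, f k • x ≠ f n • x}
  have key : ∀ x, (fiber G (Subtype.val ⁻¹' B) x : Set X) = (fun n => f n • x) '' N x := by
    intro x
    ext z
    constructor
    · rintro ⟨⟨g, rfl⟩, hz⟩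
      obtain ⟨n, rfl⟩ := hf g
      classical
      have hex : ∃ k, f k • x = f n • x := ⟨n, rfl⟩
      refine ⟨Nat.find hex, ⟨?_, ?_⟩, Nat.find_spec hex⟩
      · rw [Nat.find_spec hex]; exact hz
      · intro k hk h
        exact Nat.find_min hex hk (h.trans (Nat.find_spec hex))
    · rintro ⟨n, ⟨h1, -⟩, rfl⟩
      exact ⟨⟨f n, rfl⟩, h1⟩
  have hinj : ∀ x, Set.InjOn (fun n => f n • x) (N x) := by
    intro x a ha b hb h
    rcases lt_trichotomy a b with hab | hab | hab
    · exact absurd h (hb.2 a hab)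
    · exact hab
    · exact absurd h.symm (ha.2 b hab)
  have hN : ∀ n, MeasurableSet {x | n ∈ N x} := by
    intro n
    refine MeasurableSet.inter ?_ ?_
    · exact ((measurable_const_smul (f n)).prodMk measurable_id) hB
    · have : {x : X | ∀ k < n, f k • x ≠ f n • x} =
          ⋂ k, ⋂ (_ : k < n), {x : X | f k • x = f n • x}ᶜ := by
        ext x; simp
      change MeasurableSet {x : X | ∀ k < n, f k • x ≠ f n • x}
      rw [this]
      exact MeasurableSet.iInter fun k => MeasurableSet.iInter fun _ =>
        (measurableSet_eq_fun (measurable_const_smul (f k)) (measurable_const_smul (f n))).compl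
  have heq : (fun x => ((fiber G (Subtype.val ⁻¹' B) x).encard : ℝ≥0∞)) =
      fun x => ∑' n, Set.indicator {x | n ∈ N x} (fun _ => (1 : ℝ≥0∞)) x := by
    funext x
    rw [key x, (hinj x).encard_image, ← ENNReal.tsum_set_one,
      tsum_subtype (N x) (fun _ => (1 : ℝ≥0∞))]
    rfl
  rw [heq]
  exact Measurable.tsum fun n => measurable_const.indicator (hN n)

/-- The diagonal, as a subset of `ℛ`. -/
def diag (G X : Type*) [Group G] [MulAction G X] : Set (Rel G X) := {p | p.1.1 = p.1.2}

theorem measurableSet_diag (μ : Measure X) [IsLebesgueSpace μ] :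
    MeasurableSet (diag G X) := by
  have := IsLebesgueSpace.measurableEq μ
  exact measurable_subtype_coe (measurableSet_diagonal (α := X))

/-- The measure `ν(A) = ∫ |A_x| dμ(x)` on `ℛ`. -/
def nu [Countable G] [MeasurableConstSMul G X] (μ : Measure X) [IsLebesgueSpace μ] :
    Measure (Rel G X) :=
  Measure.ofMeasurable (fun A _ => ∫⁻ x, ((fiber G A x).encard : ℝ≥0∞) ∂μ)
    (by simp [fiber])
    (by
      intro A hA hd
      have := IsLebesgueSpace.measurableEq μ
      rw [← lintegral_tsum fun i => (measurable_encard_fiber G (hA i)).aemeasurable]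
      congr 1
      funext x
      have hU : fiber G (⋃ i, A i) x = ⋃ i, fiber G (A i) x := by
        ext z
        simp only [fiber, Set.mem_iUnion, Set.mem_ofPred_eq]
        exact exists_comm
      have hdis : Pairwise (Function.onFun Disjoint fun i => fiber G (A i) x) := by
        intro i j hij
        refine Set.disjoint_left.2 ?_
        rintro z ⟨h, hi⟩ ⟨h', hj⟩
        exact Set.disjoint_left.1 (hd hij) hi hj
      rw [hU]
      let _ : MeasurableSpace X := ⊤
      have hc := measure_iUnion (μ := (Measure.count : Measure X)) hdis
        (fun i => MeasurableSpace.measurableSet_top)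
      rw [Measure.count_apply MeasurableSpace.measurableSet_top] at hc
      rw [hc]
      exact tsum_congr fun i => Measure.count_apply MeasurableSpace.measurableSet_top)

theorem nu_apply [Countable G] [MeasurableConstSMul G X] (μ : Measure X) [IsLebesgueSpace μ]
    {A : Set (Rel G X)} (hA : MeasurableSet A) :
    nu G μ A = ∫⁻ x, ((fiber G A x).encard : ℝ≥0∞) ∂μ :=
  Measure.ofMeasurable_apply A hA

variable {G}

/-- The map `(x, y) ↦ (g⁻¹ x, y)` of `ℛ`. -/
def leftShift (g : G) (p : Rel G X) : Rel G X :=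
  ⟨(g⁻¹ • p.1.1, p.1.2), (MulAction.mem_orbit_of_mem_orbit g⁻¹ p.2)⟩

/-- The map `(x, y) ↦ (x, g⁻¹ y)` of `ℛ`. -/
def rightShift (g : G) (p : Rel G X) : Rel G X :=
  ⟨(p.1.1, g⁻¹ • p.1.2), by
    have h := p.2
    rwa [← MulAction.orbit_smul g⁻¹ p.1.2] at h⟩

variable [Countable G] [MeasurableConstSMul G X]

theorem measurePreserving_leftShift (μ : Measure X) [IsLebesgueSpace μ] (g : G) :
    MeasurePreserving (leftShift g : Rel G X → Rel G X) (nu G μ) (nu G μ) := by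
  have hm : Measurable (leftShift g : Rel G X → Rel G X) := by
    refine Measurable.subtype_mk (Measurable.prodMk ?_ ?_)
    · exact (measurable_const_smul g⁻¹).comp (measurable_fst.comp measurable_subtype_coe)
    · exact measurable_snd.comp measurable_subtype_coe
  refine ⟨hm, ?_⟩
  ext A hA
  rw [Measure.map_apply hm hA, nu_apply G μ hA, nu_apply G μ (hm hA)]
  refine lintegral_congr fun x => ?_
  have : fiber G (leftShift g ⁻¹' A) x = (fun z => g • z) '' fiber G A x := by
    ext z
    constructor
    · rintro ⟨h, hz⟩
      exact ⟨g⁻¹ • z, ⟨_, hz⟩, smul_inv_smul g z⟩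
    · rintro ⟨w, ⟨h, hw⟩, rfl⟩
      refine ⟨MulAction.mem_orbit_of_mem_orbit g h, ?_⟩
      simpa [leftShift] using hw
  rw [this, (MulAction.injective g).encard_image]

theorem measurePreserving_rightShift (μ : Measure X) [IsLebesgueSpace μ]
    [SMulInvariantMeasure G X μ] (g : G) :
    MeasurePreserving (rightShift g : Rel G X → Rel G X) (nu G μ) (nu G μ) := by
  have := IsLebesgueSpace.measurableEq μ
  have hm : Measurable (rightShift g : Rel G X → Rel G X) := by
    refine Measurable.subtype_mk (Measurable.prodMk ?_ ?_)
    · exact measurable_fst.comp measurable_subtype_coe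
    · exact (measurable_const_smul g⁻¹).comp (measurable_snd.comp measurable_subtype_coe)
  refine ⟨hm, ?_⟩
  ext A hA
  rw [Measure.map_apply hm hA, nu_apply G μ hA, nu_apply G μ (hm hA)]
  rw [← (measurePreserving_smul g⁻¹ μ).lintegral_comp (measurable_encard_fiber G hA)]
  refine lintegral_congr fun x => ?_
  have : fiber G (rightShift g ⁻¹' A) x = fiber G A (g⁻¹ • x) := by
    ext z
    constructor
    · rintro ⟨h, hz⟩
      exact ⟨_, hz⟩
    · rintro ⟨h, hz⟩
      exact ⟨by rwa [MulAction.orbit_smul] at h, hz⟩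
  rw [this]

variable (G) in
/-- The Hilbert space `L²(ℛ, ν)`. -/
abbrev L2 (μ : Measure X) [IsLebesgueSpace μ] : Type _ := Lp ℂ 2 (nu G μ)

/-- The left groupoid representation, `(π(g) f)(x, y) = f(g⁻¹ x, y)`. -/
def leftRep (μ : Measure X) [IsLebesgueSpace μ] (g : G) : L2 G μ →L[ℂ] L2 G μ :=
  (Lp.compMeasurePreservingₗᵢ ℂ (leftShift g)
    (measurePreserving_leftShift μ g)).toContinuousLinearMap

/-- The right groupoid representation, `(π̃(g) f)(x, y) = f(x, g⁻¹ y)`. -/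
def rightRep (μ : Measure X) [IsLebesgueSpace μ] [SMulInvariantMeasure G X μ] (g : G) :
    L2 G μ →L[ℂ] L2 G μ :=
  (Lp.compMeasurePreservingₗᵢ ℂ (rightShift g)
    (measurePreserving_rightShift μ g)).toContinuousLinearMap

/-- The representation `ρ(g₁, g₂) = π(g₁) π̃(g₂)` of `G × G` in `L²(ℛ, ν)`. -/
def rho (μ : Measure X) [IsLebesgueSpace μ] [SMulInvariantMeasure G X μ] (g : G × G) :
    L2 G μ →L[ℂ] L2 G μ :=
  leftRep μ g.1 * rightRep μ g.2

variable (G) in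
/-- The von Neumann algebra generated by the operators `ρ(g₁, g₂)`. -/
def algebraRho (μ : Measure X) [IsLebesgueSpace μ] [SMulInvariantMeasure G X μ] :
    VonNeumannAlgebra (L2 G μ) :=
  generatedVonNeumannAlgebra (Set.range (rho (G := G) μ))

variable (G) in
theorem nu_diag (μ : Measure X) [IsLebesgueSpace μ] : nu G μ (diag G X) = 1 := by
  rw [nu_apply G μ (measurableSet_diag G μ)]
  have : ∀ x : X, fiber G (diag G X) x = {x} := by
    intro x
    ext z
    constructor
    · rintro ⟨h', h⟩
      exact h
    · rintro rfl
      exact ⟨MulAction.mem_orbit_self z, rfl⟩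
  simp [this]

variable (G) in
/-- The vector `ξ(x, y) = δ_{x,y}`: the indicator function of the diagonal in `L²(ℛ, ν)`. -/
def xi (μ : Measure X) [IsLebesgueSpace μ] : L2 G μ :=
  indicatorConstLp 2 (measurableSet_diag G μ) (by rw [nu_diag]; exact ENNReal.one_ne_top) (1 : ℂ)

end Defs

end OrbitGroupoid

end

open scoped InnerProductSpace Pointwise

/-! A vector η fixed by all ρ(g,g) is constant along diagonal G-orbits in ℛ. Since η is square
integrable, {|η| ≥ 1/n} has finite ν-measure, so almost all its fibers are finite. If η(x,y) ≠ 0,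
such a fiber over y contains the St(y)-orbit of x, so St(x) ∩ St(y) has finite index in St(y). The
flip preserves ν, which gives finite index in St(x) too. Writing x = gy, St(x) = g St(y) g⁻¹, so g
commensurates St(y), hence fixes y, and x = y (`eq_of_finite_fiber`, `ae_eq_zero_of_ne`). So η lives
on the diagonal, where ergodicity makes it constant. For the projection: an operator commuting with
every ρ(g₁,g₂) sends ξ to a fixed vector, hence to a multiple of ξ. Its adjoint does the same, so it
commutes with P_ξ, and P_ξ lies in the double commutant. -/

/-- If `ξ` is a unit vector that spans the space of common fixed vectors of a family of operators
in `S`, then the projection onto `ℂ ξ` belongs to the von Neumann algebra generated by `S`. -/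
theorem starProjection_mem_generatedVonNeumannAlgebra {H : Type*} [NormedAddCommGroup H]
    [InnerProductSpace ℂ H] [CompleteSpace H] {S T : Set (H →L[ℂ] H)} (hTS : T ⊆ S) {ξ : H}
    (hξ : ‖ξ‖ = 1) (hfix : ∀ η : H, (∀ u ∈ T, u η = η) ↔ ∃ c : ℂ, η = c • ξ) :
    (ℂ ∙ ξ).starProjection ∈ generatedVonNeumannAlgebra S := by
  have hξT : ∀ u ∈ T, u ξ = ξ := (hfix ξ).2 ⟨1, (one_smul ℂ ξ).symm⟩
  have hscal : ∀ a ∈ StarSubalgebra.centralizer ℂ S, ∃ c : ℂ, a ξ = c • ξ := by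
    intro a ha
    refine (hfix (a ξ)).1 fun u hu => ?_
    have h := (StarSubalgebra.mem_centralizer_iff ℂ).1 ha u (hTS hu)
    have h1 := congrArg (fun v : H →L[ℂ] H => v ξ) h.1
    simpa [hξT u hu] using h1
  have hcomm : ∀ a ∈ StarSubalgebra.centralizer ℂ S,
      a * (ℂ ∙ ξ).starProjection = (ℂ ∙ ξ).starProjection * a := by
    intro a ha
    obtain ⟨c, hc⟩ := hscal a ha
    obtain ⟨d, hd⟩ := hscal (star a) (star_mem ha)
    -- The eigenvalue of the adjoint at ξ controls the ξ-component of `a w`; testing at `w = ξ` then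
    -- identifies the two eigenvalues.
    have hinner : ∀ w, ⟪ξ, a w⟫_ℂ = (starRingEnd ℂ) d * ⟪ξ, w⟫_ℂ := by
      intro w
      rw [← ContinuousLinearMap.adjoint_inner_left, ← ContinuousLinearMap.star_eq_adjoint, hd,
        inner_smul_left]
    have hcd : c = (starRingEnd ℂ) d := by
      have := hinner ξ
      rwa [hc, inner_smul_right, inner_self_eq_norm_sq_to_K, hξ, RCLike.ofReal_one, one_pow,
        mul_one, mul_one] at this
    ext w
    simp only [mul_apply_eq_comp, Submodule.starProjection_unit_singleton ℂ hξ,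
      map_smul, hc, hinner, smul_smul, hcd, mul_comm]
  change _ ∈ StarSubalgebra.centralizer ℂ (StarSubalgebra.centralizer ℂ S : Set (H →L[ℂ] H))
  exact (StarSubalgebra.mem_centralizer_iff ℂ).2 fun a ha =>
    ⟨hcomm a ha, hcomm (star a) (star_mem ha)⟩

namespace OrbitGroupoid

section Lemmas

variable {G X : Type*} [Group G] [MulAction G X]

/-! ### Finite fibers and commensurable stabilizers -/

/-- A point with finite orbit under `St(y)` has a stabilizer of finite relative index. -/
theorem relIndex_stabilizer_ne_zero {x y : X} {F : Set X} (hF : F.Finite)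
    (h : ∀ k ∈ MulAction.stabilizer G y, k • x ∈ F) :
    (MulAction.stabilizer G x).relIndex (MulAction.stabilizer G y) ≠ 0 := by
  have hs : (MulAction.stabilizer G x).subgroupOf (MulAction.stabilizer G y) =
      MulAction.stabilizer (MulAction.stabilizer G y) x := by
    ext k
    rfl
  have hfin : (MulAction.orbit (MulAction.stabilizer G y) x).Finite := by
    refine hF.subset ?_
    rintro _ ⟨k, rfl⟩
    exact h k k.2
  -- Orbit-stabilizer. Infinite index and infinite `ncard` are both recorded as 0, so `hfin` is what
  -- makes the value nonzero.
  rw [Subgroup.relIndex, hs, MulAction.index_stabilizer]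
  exact ((Set.ncard_pos hfin).2 (MulAction.nonempty_orbit x)).ne'

/-- The flip `(x, y) ↦ (y, x)` of `ℛ`. -/
def flip (p : Rel G X) : Rel G X :=
  ⟨(p.1.2, p.1.1), MulAction.mem_orbit_symm.1 p.2⟩

/-- If `A ⊆ ℛ` contains the diagonal orbit of `(x, y)`, the fiber of `A` over `y` and that of the
flip of `A` over `x` are finite, and `St(y)` is its own commensurator, then `x = y`. -/
theorem eq_of_finite_fiber {A : Set (Rel G X)} {x y : X} (hx : x ∈ MulAction.orbit G y)
    (hmem : ∀ (k : G) (hk : k • x ∈ MulAction.orbit G (k • y)),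
      (⟨(k • x, k • y), hk⟩ : Rel G X) ∈ A)
    (h1 : (fiber G A y).Finite) (h2 : (fiber G (flip ⁻¹' A) x).Finite)
    (hc : Subgroup.Commensurable.commensurator (MulAction.stabilizer G y) =
      MulAction.stabilizer G y) : x = y := by
  have horb (k : G) : k • x ∈ MulAction.orbit G (k • y) := by
    rw [MulAction.orbit_smul]
    exact MulAction.mem_orbit_of_mem_orbit k hx
  have hi1 : (MulAction.stabilizer G x).relIndex (MulAction.stabilizer G y) ≠ 0 := by
    refine relIndex_stabilizer_ne_zero h1 fun k hk => ?_
    -- As k fixes y, the pair (kx, ky) ∈ A is a point of the fiber over y itself.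
    have hky : k • y = y := hk
    have h := hmem k (horb k)
    refine ⟨by simpa only [hky] using horb k, ?_⟩
    simpa only [hky] using h
  obtain ⟨g, rfl⟩ := hx
  have hi2 : (MulAction.stabilizer G y).relIndex (MulAction.stabilizer G (g • y)) ≠ 0 := by
    refine relIndex_stabilizer_ne_zero h2 fun k hk => ?_
    have hkx : k • g • y = g • y := hk
    have h := hmem k (horb k)
    refine ⟨MulAction.mem_orbit_symm.1 (by simpa only [hkx] using horb k), ?_⟩
    change (⟨(g • y, k • y), _⟩ : Rel G X) ∈ A
    simpa only [hkx] using h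
  have hst : ConjAct.toConjAct g • MulAction.stabilizer G y = MulAction.stabilizer G (g • y) := by
    rw [MulAction.stabilizer_smul_eq_stabilizer_map_conj]
    rfl
  have hg : g ∈ Subgroup.Commensurable.commensurator (MulAction.stabilizer G y) := by
    rw [Subgroup.Commensurable.commensurator_mem_iff, hst]
    exact ⟨hi1, hi2⟩
  rw [hc] at hg
  exact hg

variable [MeasurableSpace X]

theorem measurable_flip : Measurable (flip : Rel G X → Rel G X) :=
  Measurable.subtype_mk
    ((measurable_snd.comp measurable_subtype_coe).prodMk
      (measurable_fst.comp measurable_subtype_coe))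

variable [MeasurableConstSMul G X] [Countable G] (μ : Measure X)

theorem ae_forall_smul [SMulInvariantMeasure G X μ] {P : X → Prop} (h : ∀ᵐ x ∂μ, P x) :
    ∀ᵐ x ∂μ, ∀ g : G, P (g • x) :=
  ae_all_iff.2 fun g => (measurePreserving_smul g μ).quasiMeasurePreserving.ae h

variable [IsLebesgueSpace μ]

/-! ### The measure ν: graphs, flip and fibers -/

/-- The part of `ν` on the graph of `g`. -/
theorem nu_inter_graph {A : Set (Rel G X)} (hA : MeasurableSet A) (g : G) :
    nu G μ (A ∩ {p | p.1.1 = g • p.1.2}) =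
      μ {y | (⟨(g • y, y), MulAction.mem_orbit y g⟩ : Rel G X) ∈ A} := by
  have := IsLebesgueSpace.measurableEq μ
  have hg : MeasurableSet {p : Rel G X | p.1.1 = g • p.1.2} :=
    measurableSet_eq_fun (measurable_fst.comp measurable_subtype_coe)
      ((measurable_snd.comp measurable_subtype_coe).const_smul g)
  have hm : MeasurableSet {y | (⟨(g • y, y), MulAction.mem_orbit y g⟩ : Rel G X) ∈ A} :=
    (Measurable.subtype_mk ((measurable_const_smul g).prodMk measurable_id)) hA
  rw [nu_apply G μ (hA.inter hg), ← lintegral_indicator_one hm]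
  refine lintegral_congr fun y => ?_
  by_cases hy : (⟨(g • y, y), MulAction.mem_orbit y g⟩ : Rel G X) ∈ A
  · have : fiber G (A ∩ {p | p.1.1 = g • p.1.2}) y = {g • y} := by
      ext z
      constructor
      · rintro ⟨_, -, h⟩
        exact h
      · rintro rfl
        exact ⟨MulAction.mem_orbit y g, hy, rfl⟩
    rw [this, Set.indicator_of_mem (show y ∈ {y | (⟨(g • y, y), MulAction.mem_orbit y g⟩ : Rel G X) ∈ A} from hy)]
    simp
  · have : fiber G (A ∩ {p | p.1.1 = g • p.1.2}) y = ∅ := by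
      refine Set.eq_empty_of_forall_notMem ?_
      rintro z ⟨hz, h, h'⟩
      obtain rfl : z = g • y := h'
      exact hy h
    rw [this, Set.indicator_of_notMem (show ¬ y ∈ {y | (⟨(g • y, y), MulAction.mem_orbit y g⟩ : Rel G X) ∈ A} from hy)]
    simp

/-- The flip preserves `ν`. -/
theorem measurePreserving_flip [SMulInvariantMeasure G X μ] :
    MeasurePreserving (flip : Rel G X → Rel G X) (nu G μ) (nu G μ) := by
  have := IsLebesgueSpace.measurableEq μ
  have hg (g : G) : MeasurableSet {p : Rel G X | p.1.1 = g • p.1.2} :=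
    measurableSet_eq_fun (measurable_fst.comp measurable_subtype_coe)
      ((measurable_snd.comp measurable_subtype_coe).const_smul g)
  refine ⟨measurable_flip, ?_⟩
  -- The graphs of the countably many g cover ℛ; they may overlap, but agreement on each piece of a
  -- countable cover suffices.
  have hU : ⋃ g : G, {p : Rel G X | p.1.1 = g • p.1.2} = Set.univ := by
    refine Set.eq_univ_of_forall fun p => ?_
    obtain ⟨g, hgp⟩ := p.2
    exact Set.mem_iUnion.2 ⟨g, hgp.symm⟩
  refine (Measure.ext_iff_of_iUnion_eq_univ hU).2 fun g => ?_
  ext A hA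
  rw [Measure.restrict_apply hA, Measure.restrict_apply hA,
    Measure.map_apply measurable_flip (hA.inter (hg g)), nu_inter_graph μ hA g]
  -- The flip exchanges the graphs of g and g⁻¹; invariance of μ under y ↦ g⁻¹y then matches the two
  -- measures.
  have hpre : flip ⁻¹' (A ∩ {p : Rel G X | p.1.1 = g • p.1.2}) =
      flip ⁻¹' A ∩ {p : Rel G X | p.1.1 = g⁻¹ • p.1.2} := by
    ext p
    refine and_congr_right fun _ => ?_
    change p.1.2 = g • p.1.1 ↔ p.1.1 = g⁻¹ • p.1.2
    rw [eq_inv_smul_iff, eq_comm]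
  have hm : MeasurableSet {y | (⟨(g • y, y), MulAction.mem_orbit y g⟩ : Rel G X) ∈ A} :=
    (Measurable.subtype_mk ((measurable_const_smul g).prodMk measurable_id)) hA
  rw [hpre, nu_inter_graph μ (measurable_flip hA) g⁻¹,
    ← (measurePreserving_smul g⁻¹ μ).measure_preimage hm.nullMeasurableSet]
  congr 1
  ext y
  simp only [Set.mem_ofPred_eq, Set.mem_preimage, flip, smul_inv_smul]

/-- A ν-null set has fiber cardinality of integral zero, so almost all its fibers are empty, not
merely small. -/
theorem ae_forall_fiber_of_ae_nu {P : Rel G X → Prop} (h : ∀ᵐ p ∂nu G μ, P p) :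
    ∀ᵐ y ∂μ, ∀ (x : X) (hx : x ∈ MulAction.orbit G y), P ⟨(x, y), hx⟩ := by
  have := IsLebesgueSpace.measurableEq μ
  obtain ⟨N, hN, hNm, hN0⟩ := exists_measurable_superset_of_null (ae_iff.1 h)
  rw [nu_apply G μ hNm, lintegral_eq_zero_iff (measurable_encard_fiber G hNm)] at hN0
  filter_upwards [hN0] with y hy x hx
  have hy' : fiber G N y = ∅ := by simpa using hy
  by_contra hP
  exact Set.notMem_empty x (hy' ▸ (⟨hx, hN hP⟩ : x ∈ fiber G N y))

theorem ae_nu_of_ae_forall_fiber {P : Rel G X → Prop} (hP : MeasurableSet {p | P p})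
    (h : ∀ᵐ y ∂μ, ∀ (x : X) (hx : x ∈ MulAction.orbit G y), P ⟨(x, y), hx⟩) :
    ∀ᵐ p ∂nu G μ, P p := by
  have := IsLebesgueSpace.measurableEq μ
  rw [ae_iff]
  have hm : MeasurableSet {p | ¬ P p} := hP.compl
  rw [nu_apply G μ hm, lintegral_eq_zero_iff (measurable_encard_fiber G hm)]
  filter_upwards [h] with y hy
  have : fiber G {p | ¬ P p} y = ∅ := by
    refine Set.eq_empty_of_forall_notMem ?_
    rintro z ⟨hz, h'⟩
    exact h' (hy z hz)
  simp [this]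

theorem ae_finite_fiber {A : Set (Rel G X)} (hA : MeasurableSet A) (hfin : nu G μ A ≠ ∞) :
    ∀ᵐ y ∂μ, (fiber G A y).Finite := by
  have := IsLebesgueSpace.measurableEq μ
  rw [nu_apply G μ hA] at hfin
  filter_upwards [ae_lt_top (measurable_encard_fiber G hA) hfin] with y hy
  rw [← Set.encard_lt_top_iff]
  simpa using hy

/-! ### The vector ξ and superlevel sets -/

theorem coeFn_xi : xi G μ =ᵐ[nu G μ] (diag G X).indicator fun _ => (1 : ℂ) :=
  indicatorConstLp_coeFn

theorem norm_xi : ‖xi G μ‖ = 1 := by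
  rw [xi, norm_indicatorConstLp (by norm_num) (by norm_num), Measure.real, nu_diag]
  simp

/-- The set of points of `ℛ` where `|η|` is at least `1 / n`. -/
def superlevel (η : L2 G μ) (n : ℕ) : Set (Rel G X) := {p | (n : ℝ≥0∞)⁻¹ ≤ ‖η p‖ₑ}

theorem measurableSet_superlevel (η : L2 G μ) (n : ℕ) : MeasurableSet (superlevel μ η n) :=
  measurableSet_le measurable_const (Lp.stronglyMeasurable η).measurable.enorm

/-- Chebyshev's inequality in L². For n = 0 the threshold is ∞ and the set is empty, so this case
needs no exclusion. -/
theorem nu_superlevel_ne_top (η : L2 G μ) (n : ℕ) : nu G μ (superlevel μ η n) ≠ ∞ :=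
  ((Lp.memLp η).meas_ge_lt_top'_enorm two_ne_zero ENNReal.ofNat_ne_top
    (ENNReal.inv_ne_zero.2 (ENNReal.natCast_ne_top n)) (by simp)).ne

theorem exists_mem_superlevel {η : L2 G μ} {p : Rel G X} (hp : η p ≠ 0) :
    ∃ n, p ∈ superlevel μ η n := by
  obtain ⟨n, hn⟩ := ENNReal.exists_inv_nat_lt (enorm_ne_zero.2 hp)
  exact ⟨n, hn.le⟩

theorem mem_superlevel_congr {η : L2 G μ} {p q : Rel G X} (h : η p = η q) (n : ℕ) :
    p ∈ superlevel μ η n ↔ q ∈ superlevel μ η n := by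
  rw [superlevel, Set.mem_ofPred_eq, Set.mem_ofPred_eq, h]

variable [SMulInvariantMeasure G X μ]

/-! ### Vectors fixed by the diagonal representation -/

theorem coeFn_rho (g : G) (η : L2 G μ) :
    rho μ (g, g) η =ᵐ[nu G μ] fun p => η (rightShift g (leftShift g p)) := by
  have h : rho μ (g, g) η = Lp.compMeasurePreserving _ (measurePreserving_leftShift μ g)
      (Lp.compMeasurePreserving _ (measurePreserving_rightShift μ g) η) := rfl
  rw [h]
  have h1 := Lp.coeFn_compMeasurePreserving
    (Lp.compMeasurePreserving _ (measurePreserving_rightShift μ g) η)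
    (measurePreserving_leftShift μ g)
  have h2 := Lp.coeFn_compMeasurePreserving η (measurePreserving_rightShift μ g)
  filter_upwards [h1, (measurePreserving_leftShift μ g).quasiMeasurePreserving.ae h2] with p a b
  rw [a]
  exact b

theorem rho_xi (g : G) : rho μ (g, g) (xi G μ) = xi G μ := by
  refine Lp.ext ?_
  have h := (measurePreserving_rightShift μ g).comp (measurePreserving_leftShift μ g)
  filter_upwards [coeFn_rho μ g (xi G μ), coeFn_xi (G := G) μ,
    h.quasiMeasurePreserving.ae (coeFn_xi (G := G) μ)] with p h1 h2 h3
  rw [h1, h2]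
  refine h3.trans ?_
  have hd : rightShift g (leftShift g p) ∈ diag G X ↔ p ∈ diag G X := by
    change g⁻¹ • p.1.1 = g⁻¹ • p.1.2 ↔ p.1.1 = p.1.2
    exact (MulAction.injective g⁻¹).eq_iff
  by_cases hp : p ∈ diag G X
  · simp [hp, hd.2 hp]
  · simp [hp, mt hd.1 hp]

/-- A fixed vector is, almost everywhere, constant along the orbits of the diagonal action. -/
theorem ae_smul_eq_of_forall_rho_eq {η : L2 G μ} (hη : ∀ g : G, rho μ (g, g) η = η) :
    ∀ᵐ y ∂μ, ∀ (g : G) (x : X) (hx : x ∈ MulAction.orbit G y)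
      (hgx : g • x ∈ MulAction.orbit G (g • y)),
      η ⟨(g • x, g • y), hgx⟩ = η ⟨(x, y), hx⟩ := by
  refine ae_all_iff.2 fun g => ?_
  -- Shifting by g⁻¹ moves points by g.
  have h : ∀ᵐ p ∂nu G μ, η p = η (rightShift g⁻¹ (leftShift g⁻¹ p)) := by
    have := coeFn_rho μ g⁻¹ η
    rwa [hη] at this
  filter_upwards [ae_forall_fiber_of_ae_nu μ h] with y hy x hx hgx
  rw [hy x hx]
  congr 1
  simp [rightShift, leftShift]

/-- A fixed vector vanishes off the diagonal if stabilizers are self-commensurating. -/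
theorem ae_eq_zero_of_ne {η : L2 G μ} (hη : ∀ g : G, rho μ (g, g) η = η)
    (hcomm : ∀ᵐ x ∂μ, Subgroup.Commensurable.commensurator (MulAction.stabilizer G x) =
      MulAction.stabilizer G x) :
    ∀ᵐ y ∂μ, ∀ (x : X) (hx : x ∈ MulAction.orbit G y), x ≠ y → η ⟨(x, y), hx⟩ = 0 := by
  have hAm := measurableSet_superlevel μ η
  have h1 : ∀ᵐ y ∂μ, ∀ n, (fiber G (superlevel μ η n) y).Finite :=
    ae_all_iff.2 fun n => ae_finite_fiber μ (hAm n) (nu_superlevel_ne_top μ η n)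
  -- The flipped fiber is needed over x = gy, not over y, so almost every y must have all its
  -- translates good; G is countable.
  have h2 : ∀ᵐ y ∂μ, ∀ g : G, ∀ n, (fiber G (flip ⁻¹' superlevel μ η n) (g • y)).Finite := by
    refine ae_forall_smul μ (ae_all_iff.2 fun n => ae_finite_fiber μ (measurable_flip (hAm n)) ?_)
    rw [(measurePreserving_flip μ).measure_preimage (hAm n).nullMeasurableSet]
    exact nu_superlevel_ne_top μ η n
  filter_upwards [h1, h2, ae_smul_eq_of_forall_rho_eq μ hη, hcomm] with y h1 h2 hinv hc x hx hne
  by_contra h0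
  obtain ⟨n, hn⟩ := exists_mem_superlevel μ h0
  obtain ⟨g, hg⟩ := id hx
  have hgx : g • y = x := hg
  exact hne (eq_of_finite_fiber hx
    (fun k hk => (mem_superlevel_congr μ (hinv k x hx hk) n).2 hn) (h1 n) (hgx ▸ h2 g n) hc)

end Lemmas

/-- An almost everywhere invariant function on an ergodic `G`-space is almost everywhere
constant. -/
theorem ae_eq_const_of_ergodicSMul {G X : Type*} [Group G] [MulAction G X] [MeasurableSpace X]
    (μ : Measure X) [ErgodicSMul G X μ] {f : X → ℂ} (hf : Measurable f)
    (h : ∀ g : G, ∀ᵐ x ∂μ, f (g • x) = f x) : ∃ c, ∀ᵐ x ∂μ, f x = c := by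
  -- Countably many measurable sets separate the points of ℂ, so it is enough that each preimage,
  -- being almost invariant, is null or conull.
  refine Filter.exists_eventuallyEq_const_of_forall_separating MeasurableSet fun U hU => ?_
  have := aeconst_of_forall_preimage_smul_ae_eq G (μ := μ) (s := f ⁻¹' U)
    (hf hU).nullMeasurableSet fun g => by
      filter_upwards [h g] with x hx
      exact congrArg (· ∈ U) hx
  exact Filter.eventuallyConst_pred.1 this

end OrbitGroupoid

open OrbitGroupoid in
/-- The fixed vectors of the diagonal representation are the multiples of `ξ`. -/
theorem OrbitGroupoid.forall_rho_eq_iff {G X : Type*} [Group G] [Countable G] [MulAction G X]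
    [MeasurableSpace X] [MeasurableConstSMul G X]
    (μ : Measure X) [IsLebesgueSpace μ] [ErgodicSMul G X μ]
    (hcomm : ∀ᵐ x ∂μ, Subgroup.Commensurable.commensurator (MulAction.stabilizer G x) =
      MulAction.stabilizer G x) (η : L2 G μ) :
    (∀ g : G, rho μ (g, g) η = η) ↔ ∃ c : ℂ, η = c • xi G μ := by
  constructor
  · intro hη
    have hηm : Measurable η := (Lp.stronglyMeasurable η).measurable
    -- The diagonal embedding is equivariant, so η restricted to the diagonal is an invariant
    -- function on X.
    let d : X → Rel G X := fun x => ⟨(x, x), MulAction.mem_orbit_self x⟩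
    have hd : Measurable d := Measurable.subtype_mk (measurable_id.prodMk measurable_id)
    obtain ⟨c, hc⟩ := ae_eq_const_of_ergodicSMul (G := G) μ (hηm.comp hd) fun g => by
      filter_upwards [ae_smul_eq_of_forall_rho_eq μ hη] with y hy
      exact hy g y _ (MulAction.mem_orbit_self _)
    refine ⟨c, Lp.ext ?_⟩
    have hmd := measurableSet_diag G μ
    have key : ∀ᵐ p ∂nu G μ, η p = c * (diag G X).indicator (fun _ => (1 : ℂ)) p := by
      refine ae_nu_of_ae_forall_fiber μ
        (measurableSet_eq_fun hηm ((measurable_const.indicator hmd).const_mul c)) ?_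
      filter_upwards [hc, ae_eq_zero_of_ne μ hη hcomm] with y hy hy0 x hx
      by_cases hxy : x = y
      · subst hxy
        rw [Set.indicator_of_mem (show _ ∈ diag G X from rfl), mul_one]
        exact hy
      · rw [Set.indicator_of_notMem (show _ ∉ diag G X from hxy), mul_zero]
        exact hy0 x hx hxy
    filter_upwards [key, coeFn_xi (G := G) μ, Lp.coeFn_smul c (xi G μ)] with p h1 h2 h3
    rw [h1, h3, Pi.smul_apply, h2, smul_eq_mul]
  · rintro ⟨c, rfl⟩ g
    rw [map_smul, rho_xi]

theorem mainTheorem11 {G X : Type*} [Group G] [Countable G] [MulAction G X]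
    [MeasurableSpace X] [MeasurableConstSMul G X]
    (μ : Measure X) [IsLebesgueSpace μ] [ErgodicSMul G X μ]
    (hcomm : ∀ᵐ x ∂μ, Subgroup.Commensurable.commensurator (MulAction.stabilizer G x) =
      MulAction.stabilizer G x) :
    (‖OrbitGroupoid.xi G μ‖ = 1 ∧
      ∀ η : OrbitGroupoid.L2 G μ,
        (∀ g : G, OrbitGroupoid.rho μ (g, g) η = η) ↔ ∃ c : ℂ, η = c • OrbitGroupoid.xi G μ) ∧
    (ℂ ∙ OrbitGroupoid.xi G μ).starProjection ∈ OrbitGroupoid.algebraRho G μ := by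
  have hfix := OrbitGroupoid.forall_rho_eq_iff (G := G) μ hcomm
  refine ⟨⟨OrbitGroupoid.norm_xi μ, hfix⟩, ?_⟩
  -- The diagonal operators alone determine the fixed line, while the algebra is generated by all
  -- ρ(g₁,g₂).
  refine starProjection_mem_generatedVonNeumannAlgebra
    (T := Set.range fun g : G => OrbitGroupoid.rho μ (g, g)) ?_ (OrbitGroupoid.norm_xi μ)
    fun η => Set.forall_mem_range.trans (hfix η)
  rintro _ ⟨g, rfl⟩
  exact ⟨(g, g), rfl⟩
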